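/- **Setting.** Consider a finite-horizon Markov decision process with periods $0,\dots,T$, state space $\mathcal S$, actions in a real normed space $\mathcal A$ (e.g. $\mathbb R^m$), transition kernels $\mathbb P_t(\cdot\mid s,a)$ and costs $c_t(s,a,s')$; time is regarded as a component of the state, so all data may depend on $t$. For a law $F$ on $\mathbb R$ let $\breve F(u)=\inf\{z: F(z)\ge u\}$ be its quantile function, and let $\langle\cdot,\cdot\rangle,\|\cdot\|$ be the inner product and norm of $L^2([0,1])$. Each state $s$ at time $t$ carries a tolerance $\epsilon_{s}\ge 0$ and a nondecreasing distortion weight $\gamma_{s}:[0,1]\to[0,\infty)$ with $\int_0^1\gamma_{s}=1$. The moment-constrained Wasserstein set $\varsigma^{\epsilon}_F$ consists of all laws $G$ of bounded random variables with $\|\breve F-\breve G\|\le\epsilon$, $\langle\breve F,1\rangle=\langle\breve G,1\rangle$ and $\|\breve F\|^2=\|\breve G\|^2$. For a policy $\pi^\theta_t:\mathcal S\to\mathcal A$, with $\theta$ in a real normed space (e.g. $\mathbb R^n$), put $V_{T+1}=0$ and, for $t\le T$, $$Q_t(s,a;\theta)=\sup_{G\in\varsigma^{\epsilon_s}_{F_{\theta,t}(\cdot|s,a)}}\langle\gamma_s,\breve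 G\rangle,\qquad V_t(s;\theta)=Q_t(s,\pi_t^\theta(s);\theta),$$ where $F_{\theta,t}(\cdot|s,a)$ is the law, given $s_t=s,\ a_t=a$, of the cost-to-go $Z_t^\theta=c_t(s,a,s_{t+1})+V_{t+1}(s_{t+1};\theta)$. Fix $t\le T$, a state $s$ and a parameter $\theta$, and write $Q^{\epsilon}_t(s,\cdot\,;\cdot)$, $V^\epsilon_t(s;\cdot)$ for the functions obtained when the tolerance of the state $s$ at time $t$ is $\epsilon$ and all other tolerances are kept fixed. ($Q^{0}_t(s,a;\theta)=\langle\gamma_s,\breve F_{\theta,t}(\cdot|s,a)\rangle$ is the Q-function without robustness at $s$.) **Assumptions.** The map $\eta\mapsto\pi_t^\eta(s)$ is differentiable at $\theta$; for all $a$ near $\pi_t^\theta(s)$ the cost-to-go $Z_t^\theta$ given $(s,a)$ is a (measurable) essentially bounded random variable; the map $a\mapsto\breve F_{\theta,t}(\cdot|s,a)\in L^2([0,1])$ is Fréchet differentiable at $a=\pi_t^\theta(s)$; and $F_{\theta,t}(\cdot|s,\pi_t^\theta(s))$ has variance $\sigma^2>0$. **Claim.** 1. $Q_t^{0}(s,\cdot\,;\theta)$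 is differentiable at $\pi_t^\theta(s)$, so is $Q_t^{\epsilon}(s,\cdot\,;\theta)$ for all sufficiently small $\epsilon>0$, and $\nabla_aQ_t^{\epsilon}(s,a;\theta)|_{a=\pi_t^\theta(s)}\to\nabla_aQ_t^{0}(s,a;\theta)|_{a=\pi_t^\theta(s)}$ as $\epsilon\downarrow0$. 2. (Deterministic policy gradient.) Differentiate the value $V_t^\epsilon(s;\theta)=Q^\epsilon_t(s,\pi_t^\theta(s);\theta)$ through the action $\pi^\theta_t(s)$ taken in $s$ at time $t$, the policy of the later periods being held fixed. For all sufficiently small $\epsilon>0$ the function $\eta\mapsto Q_t^{\epsilon}(s,\pi_t^\eta(s);\theta)$ is differentiable at $\eta=\theta$, and $$\lim_{\epsilon\downarrow0}\nabla_\eta Q_t^{\epsilon}(s,\pi_t^\eta(s);\theta)\big|_{\eta=\theta}=\nabla_aQ_t^{0}(s,a;\theta)\big|_{a=\pi_t^\theta(s)}\,\nabla_\theta\pi_t^\theta(s).$$ 3. (Total gradient.) If, moreover, the boundedness assumption holds for all $(a,\eta)$ near $(\pi_t^\theta(s),\theta)$ with $Z_t^\eta$ in place of $Z_t^\theta$,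 and $(a,\eta)\mapsto\breve F_{\eta,t}(\cdot|s,a)\in L^2([0,1])$ is Fréchet differentiable at $(\pi_t^\theta(s),\theta)$, then $\eta\mapsto V^\epsilon_t(s;\eta)$ is differentiable at $\theta$ for all sufficiently small $\epsilon>0$, $\eta\mapsto Q_t^{0}(s,\pi_t^\theta(s);\eta)$ is differentiable at $\theta$, and $$\lim_{\epsilon\downarrow0}\nabla_\theta V_t^{\epsilon}(s;\theta)=\nabla_aQ_t^{0}(s,a;\theta)\big|_{a=\pi_t^\theta(s)}\,\nabla_\theta\pi_t^\theta(s)+\nabla_\eta Q^0_t(s,\pi_t^\theta(s);\eta)\big|_{\eta=\theta},$$ where the last term is the contribution of the later periods (it vanishes, for instance, if $t=T$). 4. Let $\breve F=\breve F_{\theta,t}(\cdot|s,\pi_t^\theta(s))$, $\mu=\langle\breve F,1\rangle$, $\sigma^2=\|\breve F\|^2-\mu^2$, $\sigma_\gamma^2=\|\gamma_s\|^2-1$, $\kappa=\langle\breve F,\gamma_s\rangle-\mu$, $K=\sigma^2-\epsilon^2/2$, $$\Delta=\frac{4K^2}{K^2-\sigma^4}\big(\kappa^2-\sigma^2\sigma_\gamma^2\big),\quad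 \lambda^*=\frac{-2\kappa+\sqrt\Delta}{2\sigma^2},\quad b_{\lambda^*}=\frac{\sqrt{(\lambda^*\sigma)^2+\sigma_\gamma^2+2\lambda^*\kappa}}{\sigma}.$$ If $\kappa^2<\sigma^2\sigma_\gamma^2$, then $\lambda^*\to\infty$, $b_{\lambda^*}\to\infty$ and $\lambda^*/b_{\lambda^*}\to1$ as $\epsilon\downarrow0$. -/

import Mathlib

open MeasureTheory ProbabilityTheory Filter Topology
open scoped NNReal ENNReal

noncomputable section

namespace RobustRL

/-! ### Quantile functions and the moment-constrained Wasserstein set -/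

/-- The inner product of `L²([0,1])`. -/
def ip (f g : ℝ → ℝ) : ℝ := ∫ u in (0 : ℝ)..1, f u * g u

/-- The norm of `L²([0,1])`. -/
def l2norm (f : ℝ → ℝ) : ℝ := √(ip f f)

/-- The (left-continuous) quantile function `u ↦ inf {z | F(z) ≥ u}` of a law on the real line,
where `F` is its cumulative distribution function. -/
def quantile (ν : Measure ℝ) (u : ℝ) : ℝ := sInf {z : ℝ | u ≤ ν.real (Set.Iic z)}

/-- The law of a bounded real random variable. -/
def IsBoundedLaw (ν : Measure ℝ) : Prop :=
  IsProbabilityMeasure ν ∧ ∃ C : ℝ, ∀ᵐ x ∂ν, |x| ≤ C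

/-- A nondecreasing distortion weight `γ : [0,1] → ℝ₊` with `∫ γ = 1`: the weight of a coherent
distortion risk measure. -/
structure IsDistortionWeight (γ : ℝ → ℝ) : Prop where
  nonneg : ∀ u ∈ Set.Icc (0 : ℝ) 1, 0 ≤ γ u
  mono : MonotoneOn γ (Set.Icc 0 1)
  integral_eq_one : ∫ u in (0 : ℝ)..1, γ u = 1

/-- The distortion risk measure `⟨γ, F̆⟩` of a law. -/
def distortionRisk (γ : ℝ → ℝ) (ν : Measure ℝ) : ℝ := ip γ (quantile ν)

/-- The laws of bounded random variables within 2-Wasserstein distance `ε` of `ν` that have the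
same first and second moments as `ν`. -/
def uncertaintySet (ε : ℝ≥0) (ν : Measure ℝ) : Set (Measure ℝ) :=
  {ν' | IsBoundedLaw ν' ∧
    l2norm (fun u => quantile ν u - quantile ν' u) ≤ ε ∧
    ip (quantile ν) 1 = ip (quantile ν') 1 ∧
    l2norm (quantile ν) ^ 2 = l2norm (quantile ν') ^ 2}

/-- The robust distortion risk measure: the worst case over the uncertainty set. -/
def robustRisk (ε : ℝ≥0) (γ : ℝ → ℝ) (ν : Measure ℝ) : ℝ :=
  sSup (distortionRisk γ '' uncertaintySet ε ν)

/-! ### Multipliers of the worst-case quantile function -/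

/-- `μ = ⟨F̆, 1⟩`. -/
def lawMean (ν : Measure ℝ) : ℝ := ip (quantile ν) 1

/-- `σ² = ‖F̆‖² - μ²`. -/
def lawVar (ν : Measure ℝ) : ℝ := l2norm (quantile ν) ^ 2 - lawMean ν ^ 2

/-- `σ_γ² = ‖γ‖² - 1`. -/
def weightVar (γ : ℝ → ℝ) : ℝ := l2norm γ ^ 2 - 1

/-- `⟨F̆, γ⟩ - μ`. -/
def lawCov (γ : ℝ → ℝ) (ν : Measure ℝ) : ℝ := ip (quantile ν) γ - lawMean ν

/-- `K = σ² - ε²/2`. -/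
def constK (ε : ℝ≥0) (ν : Measure ℝ) : ℝ := lawVar ν - (ε : ℝ) ^ 2 / 2

/-- `Δ`. -/
def discr (ε : ℝ≥0) (γ : ℝ → ℝ) (ν : Measure ℝ) : ℝ :=
  4 * constK ε ν ^ 2 / (constK ε ν ^ 2 - lawVar ν ^ 2) *
    (lawCov γ ν ^ 2 - lawVar ν * weightVar γ)

/-- `λ*`. -/
def lamStar (ε : ℝ≥0) (γ : ℝ → ℝ) (ν : Measure ℝ) : ℝ :=
  (-2 * lawCov γ ν + √(discr ε γ ν)) / (2 * lawVar ν)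

/-- `b_{λ*}`. -/
def bStar (ε : ℝ≥0) (γ : ℝ → ℝ) (ν : Measure ℝ) : ℝ :=
  √(lamStar ε γ ν ^ 2 * lawVar ν + weightVar γ + 2 * lamStar ε γ ν * lawCov γ ν) /
    √(lawVar ν)

/-! ### The Markov decision process, value functions and Q-functions -/

/-- A finite-horizon Markov decision process with periods `0, …, horizon` and a nondecreasing
distortion weight for every period and state. All data may depend on the period, that is, time
is treated as a component of the state. -/
structure RiskMDP (S A : Type*) [MeasurableSpace S] [MeasurableSpace A] where
  horizon : ℕ
  trans : ℕ → Kernel (S × A) S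
  markov : ∀ t, IsMarkovKernel (trans t)
  cost : ℕ → S → A → S → ℝ
  weight : ℕ → S → ℝ → ℝ
  weight_distortion : ∀ t s, IsDistortionWeight (weight t s)

namespace RiskMDP

variable {S A : Type*} [MeasurableSpace S] [MeasurableSpace A]

/-- The Q-function with `n` periods left, by backward recursion: `ε` is the field of tolerances and
`π` the policy that is followed in all later periods. -/
def qRec (M : RiskMDP S A) (ε : ℕ → S → ℝ≥0) (π : ℕ → S → A) : ℕ → ℕ → S → A → ℝ
  | 0, _, _, _ => 0
  | n + 1, t, s, a => robustRisk (ε t s) (M.weight t s)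
      ((M.trans t (s, a)).map fun s' => M.cost t s a s' + qRec M ε π n (t + 1) s' (π (t + 1) s'))

/-- The Q-function `Q_t(s, a; π)`: action `a` is taken in state `s` at time `t`, and `π` is followed
from time `t + 1` on. -/
def qFn (M : RiskMDP S A) (ε : ℕ → S → ℝ≥0) (π : ℕ → S → A) (t : ℕ) (s : S) (a : A) : ℝ :=
  M.qRec ε π (M.horizon + 1 - t) t s a

/-- The value function `V_t(s; π) = Q_t(s, π(s); π)`. -/
def valueFn (M : RiskMDP S A) (ε : ℕ → S → ℝ≥0) (π : ℕ → S → A) (t : ℕ) (s : S) : ℝ :=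
  M.qFn ε π t s (π t s)

/-- The cost-to-go `Z_t = c(s, a, s') + V_{t+1}(s'; π)` as a function of the next state. -/
def costToGo (M : RiskMDP S A) (ε : ℕ → S → ℝ≥0) (π : ℕ → S → A) (t : ℕ) (s : S) (a : A)
    (s' : S) : ℝ :=
  M.cost t s a s' + M.valueFn ε π (t + 1) s'

/-- The conditional law of the cost-to-go given `s_t = s` and `a_t = a`. -/
def costLaw (M : RiskMDP S A) (ε : ℕ → S → ℝ≥0) (π : ℕ → S → A) (t : ℕ) (s : S) (a : A) :
    Measure ℝ :=
  (M.trans t (s, a)).map (M.costToGo ε π t s a)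

/-- After the last period nothing is left to pay. -/
theorem valueFn_terminal (M : RiskMDP S A) (ε : ℕ → S → ℝ≥0) (π : ℕ → S → A) (s : S) :
    M.valueFn ε π (M.horizon + 1) s = 0 := by
  simp [valueFn, qFn, qRec]

/-- The dynamic programming equation of the Q-function. -/
theorem qFn_eq (M : RiskMDP S A) (ε : ℕ → S → ℝ≥0) (π : ℕ → S → A) {t : ℕ}
    (ht : t ≤ M.horizon) (s : S) (a : A) :
    M.qFn ε π t s a = robustRisk (ε t s) (M.weight t s) (M.costLaw ε π t s a) := by
  obtain ⟨n, hn⟩ : ∃ n, M.horizon + 1 - t = n + 1 := ⟨M.horizon - t, by omega⟩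
  have h2 : M.horizon + 1 - (t + 1) = n := by omega
  unfold qFn
  rw [hn, qRec, costLaw]
  unfold costToGo valueFn qFn
  rw [h2]

end RiskMDP

open Classical in
/-- The field of tolerances `ε` with its value at state `s` and time `t` replaced by `e`. -/
def setTol {S : Type*} (ε : ℕ → S → ℝ≥0) (t : ℕ) (s : S) (e : ℝ≥0) : ℕ → S → ℝ≥0 :=
  fun t' s' => if t' = t ∧ s' = s then e else ε t' s'

/-- The quantile functions of a parametrized family of laws are, near `x₀`, elements of
`L²([0,1])`, and they depend on the parameter in a way that is Fréchet differentiable at `x₀`. -/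
def L2QuantileDifferentiableAt {X : Type*} [NormedAddCommGroup X] [NormedSpace ℝ X]
    (law : X → Measure ℝ) (x₀ : X) : Prop :=
  ∃ Φ : X → Lp ℝ 2 (volume.restrict (Set.Ioc (0 : ℝ) 1)),
    (∀ᶠ x in 𝓝 x₀, ⇑(Φ x) =ᵐ[volume.restrict (Set.Ioc (0 : ℝ) 1)] quantile (law x)) ∧
    DifferentiableAt ℝ Φ x₀

end RobustRL

end

/-! The robust risk is a linear optimization in `L²([0,1])`. Since a competitor `g` has the same
norm as the quantile function `F`, the constraint `‖F - g‖ ≤ ε` is the same as `⟪F, g⟫ - μ² ≥ K`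
with `K = σ² - ε²/2`. So `⟪γ, g⟫` is maximized over a sphere in a hyperplane, cut by a half-space.
The maximizer has the form `μ + b⁻¹ (γ - 1 + l (F - μ))` with `l ≥ 0` and `b > 0`. It is
nondecreasing because `γ` and `F` are, hence it is again a quantile function, and monotonicity costs
nothing (`robustRisk_eq_of_kkt`).

The optimal value therefore depends on the law only through the mean `m`, the variance `s` and the
covariance `k` with `γ`, all of which are differentiable in the parameter. Write `G` for the
variance of `γ`; Cauchy-Schwarz gives `k² ≤ s G`. If this is strict at the base point, the distance
constraint binds for small `ε`, and the value is `m + k` plus terms of order `ε` and `ε²` with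
differentiable coefficients (`robustRisk_eq_of_binding`, `differentiableAt_binding_formula`). If
equality holds with `G > 0`, the constraint is slack near the base point and the value is `m + √s
√G`. This function lies above `m + k` and touches it at the base point, so both have the same
derivative there. If `G = 0`, the weight is constant and the value is `m`.
`tendsto_fderiv_robustRisk` joins the three cases.

The law of the cost-to-go at time `t` involves only later tolerances, so varying the tolerance at
`(t, s)` changes only the outermost risk measure (`qFn_setTol`). The gradient formulas then follow
from the chain rule. -/

namespace RobustRL

/-! ### Quantile functions as elements of `L²([0,1])` -/

/-- Lebesgue measure on `(0,1]`. -/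
noncomputable abbrev unitVolume : Measure ℝ := volume.restrict (Set.Ioc (0 : ℝ) 1)

instance : IsProbabilityMeasure unitVolume := ⟨by simp [unitVolume]⟩

theorem ip_eq_inner {f g : ℝ → ℝ} {F G : Lp ℝ 2 unitVolume}
    (hF : F =ᵐ[unitVolume] f) (hG : G =ᵐ[unitVolume] g) : ip f g = inner ℝ F G := by
  rw [ip, intervalIntegral.integral_of_le zero_le_one, L2.inner_def]
  apply integral_congr_ae
  filter_upwards [hF, hG] with u h1 h2
  simp [h1, h2, mul_comm]

theorem l2norm_eq_norm {f : ℝ → ℝ} {F : Lp ℝ 2 unitVolume}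
    (hF : F =ᵐ[unitVolume] f) : l2norm f = ‖F‖ := by
  rw [l2norm, ip_eq_inner hF hF, real_inner_self_eq_norm_sq, Real.sqrt_sq (norm_nonneg _)]

theorem l2norm_sub {f g : ℝ → ℝ} {F G : Lp ℝ 2 unitVolume}
    (hF : F =ᵐ[unitVolume] f) (hG : G =ᵐ[unitVolume] g) :
    l2norm (fun u => f u - g u) = ‖F - G‖ := by
  apply l2norm_eq_norm
  filter_upwards [Lp.coeFn_sub F G, hF, hG] with u h1 h2 h3
  rw [h1, Pi.sub_apply, h2, h3]

/-- For functions of equal norm this turns a bound on the distance into a lower bound on the inner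
product. -/
theorem l2norm_sub_sq {f g : ℝ → ℝ} {F G : Lp ℝ 2 unitVolume}
    (hF : F =ᵐ[unitVolume] f) (hG : G =ᵐ[unitVolume] g) :
    l2norm (fun u => f u - g u) ^ 2 = inner ℝ F F - 2 * inner ℝ F G + inner ℝ G G := by
  rw [l2norm_sub hF hG, norm_sub_sq_real, real_inner_self_eq_norm_sq, real_inner_self_eq_norm_sq]

theorem ip_comm (f g : ℝ → ℝ) : ip f g = ip g f := by
  simp only [ip, mul_comm]

theorem memLp_of_monotoneOn_of_bounded {g : ℝ → ℝ} (hg : MonotoneOn g (Set.Ioc 0 1)) {C : ℝ}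
    (hC : ∀ u ∈ Set.Ioc (0 : ℝ) 1, |g u| ≤ C) : MemLp g 2 unitVolume := by
  refine MemLp.of_bound (aemeasurable_restrict_of_monotoneOn measurableSet_Ioc
    hg).aestronglyMeasurable C ?_
  filter_upwards [ae_restrict_mem measurableSet_Ioc] with u hu
  exact hC u hu

theorem real_Iic_eq_one {ν : Measure ℝ} [IsProbabilityMeasure ν] {C : ℝ}
    (hC : ∀ᵐ x ∂ν, |x| ≤ C) : ν.real (Set.Iic C) = 1 := by
  have h : ∀ᵐ x ∂ν, x ∈ Set.Iic C := by
    filter_upwards [hC] with x hx using (abs_le.1 hx).2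
  rw [measureReal_def, (mem_ae_iff_prob_eq_one measurableSet_Iic).1 h, ENNReal.toReal_one]

theorem neg_le_of_pos_real_Iic {ν : Measure ℝ} {C : ℝ}
    (hC : ∀ᵐ x ∂ν, |x| ≤ C) {z : ℝ} (hz : 0 < ν.real (Set.Iic z)) :
    -C ≤ z := by
  by_contra! h
  have : ν (Set.Iic z) = 0 := by
    rw [measure_eq_zero_iff_ae_notMem]
    filter_upwards [hC] with x hx hx'
    have := (abs_le.1 hx).1
    simp only [Set.mem_Iic] at hx'
    linarith
  simp [Measure.real, this] at hz

/-- Positivity of `u` is essential: for `u = 0` the set is all of `ℝ`. This is why the work takes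
place on `(0,1]`. -/
theorem bddBelow_quantileSet {ν : Measure ℝ} {C : ℝ}
    (hC : ∀ᵐ x ∂ν, |x| ≤ C) {u : ℝ} (hu : 0 < u) :
    BddBelow {z : ℝ | u ≤ ν.real (Set.Iic z)} :=
  ⟨-C, fun _ hz => neg_le_of_pos_real_Iic hC (hu.trans_le hz)⟩

theorem abs_quantile_le {ν : Measure ℝ} [IsProbabilityMeasure ν] {C : ℝ}
    (hC : ∀ᵐ x ∂ν, |x| ≤ C) {u : ℝ} (hu : u ∈ Set.Ioc (0 : ℝ) 1) :
    |quantile ν u| ≤ C := by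
  have hmem : C ∈ {z : ℝ | u ≤ ν.real (Set.Iic z)} := by
    simpa [real_Iic_eq_one hC] using hu.2
  exact abs_le.2 ⟨le_csInf ⟨C, hmem⟩ fun z hz => neg_le_of_pos_real_Iic hC (hu.1.trans_le hz),
    csInf_le (bddBelow_quantileSet hC hu.1) hmem⟩

theorem monotoneOn_quantile {ν : Measure ℝ} [IsProbabilityMeasure ν] {C : ℝ}
    (hC : ∀ᵐ x ∂ν, |x| ≤ C) :
    MonotoneOn (quantile ν) (Set.Ioc 0 1) := by
  intro u hu v hv huv
  refine csInf_le_csInf (bddBelow_quantileSet hC hu.1) ⟨C, ?_⟩ fun z hz => huv.trans hz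
  simpa [real_Iic_eq_one hC] using hv.2

theorem IsBoundedLaw.memLp_quantile {ν : Measure ℝ} (h : IsBoundedLaw ν) :
    MemLp (quantile ν) 2 unitVolume := by
  obtain ⟨hp, C, hC⟩ := h
  exact memLp_of_monotoneOn_of_bounded (monotoneOn_quantile hC) fun u hu => abs_quantile_le hC hu

theorem IsBoundedLaw.map_unitVolume {g : ℝ → ℝ} (hg : MonotoneOn g (Set.Ioc 0 1)) {C : ℝ}
    (hC : ∀ u ∈ Set.Ioc (0 : ℝ) 1, |g u| ≤ C) : IsBoundedLaw (unitVolume.map g) := by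
  have hm : AEMeasurable g unitVolume := aemeasurable_restrict_of_monotoneOn measurableSet_Ioc hg
  refine ⟨Measure.isProbabilityMeasure_map hm, C, ?_⟩
  refine (ae_map_iff hm (measurableSet_le (measurable_norm (α := ℝ)) measurable_const)).2 ?_
  filter_upwards [ae_restrict_mem measurableSet_Ioc] with u hu
  exact hC u hu

/-- A bounded nondecreasing function on `(0,1]` is a.e. the quantile function of its law. -/
theorem quantile_map_unitVolume {g : ℝ → ℝ} (hg : MonotoneOn g (Set.Ioc 0 1)) {C : ℝ}
    (hC : ∀ u ∈ Set.Ioc (0 : ℝ) 1, |g u| ≤ C) :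
    quantile (unitVolume.map g) =ᵐ[unitVolume] g := by
  have hm : AEMeasurable g unitVolume := aemeasurable_restrict_of_monotoneOn measurableSet_Ioc hg
  obtain ⟨hp, C', hC'⟩ := IsBoundedLaw.map_unitVolume hg hC
  -- A monotone function has only countably many discontinuities, so it suffices to treat continuity
  -- points.
  have hcount := hg.countable_not_continuousWithinAt
  have hnull : ∀ᵐ u ∂unitVolume,
      u ∉ {x ∈ Set.Ioc (0 : ℝ) 1 | ¬ ContinuousWithinAt g (Set.Ioc 0 1) x} :=
    measure_eq_zero_iff_ae_notMem.1 (hcount.measure_zero _)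
  filter_upwards [hnull, ae_restrict_mem measurableSet_Ioc] with u hu hu01
  have hcont : ContinuousWithinAt g (Set.Ioc 0 1) u := by
    by_contra h
    exact hu ⟨hu01, h⟩
  have hcdf : ∀ z, (unitVolume.map g).real (Set.Iic z) = unitVolume.real (g ⁻¹' Set.Iic z) :=
    fun z => map_measureReal_apply_of_aemeasurable hm measurableSet_Iic
  have hmem : g u ∈ {z : ℝ | u ≤ (unitVolume.map g).real (Set.Iic z)} := by
    have h1 : unitVolume.real (Set.Ioc 0 u) = u := by
      rw [measureReal_restrict_apply measurableSet_Ioc, Set.inter_eq_left.2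
        (Set.Ioc_subset_Ioc_right hu01.2), Real.volume_real_Ioc_of_le hu01.1.le, sub_zero]
    rw [Set.mem_ofPred_eq, hcdf]
    have h2 : unitVolume.real (Set.Ioc 0 u) ≤ unitVolume.real (g ⁻¹' Set.Iic (g u)) :=
      measureReal_mono fun v hv => hg ⟨hv.1, hv.2.trans hu01.2⟩ hu01 hv.2
    rwa [h1] at h2
  apply le_antisymm
  · exact csInf_le (bddBelow_quantileSet hC' hu01.1) hmem
  -- If `z < g w`, then `{g ≤ z}` is contained in `(0, w]`, so the distribution function at `z` is
  -- at most `w < u`. Letting `w` increase to `u` gives the lower bound by continuity.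
  have hlow : ∀ w ∈ Set.Ioo 0 u, g w ≤ quantile (unitVolume.map g) u := by
    intro w hw
    refine le_csInf ⟨_, hmem⟩ fun z hz => ?_
    by_contra! hlt
    rw [Set.mem_ofPred_eq, hcdf] at hz
    have h1 : unitVolume.real (g ⁻¹' Set.Iic z) ≤ w := by
      have h2 : unitVolume.real (g ⁻¹' Set.Iic z) ≤ volume.real (Set.Ioc 0 w) := by
        rw [measureReal_def, measureReal_def]
        refine ENNReal.toReal_mono (by simp) ?_
        rw [Measure.restrict_apply' measurableSet_Ioc]
        refine measure_mono fun v hv => ⟨hv.2.1, ?_⟩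
        by_contra! hwv
        exact absurd ((hg ⟨hw.1, hw.2.le.trans hu01.2⟩ hv.2 hwv.le).trans hv.1) (not_le.2 hlt)
      rwa [Real.volume_real_Ioc_of_le hw.1.le, sub_zero] at h2
    linarith [hw.2]
  have hne : (𝓝[Set.Ioo 0 u] u).NeBot := by
    rw [← mem_closure_iff_nhdsWithin_neBot, closure_Ioo hu01.1.ne]
    exact ⟨hu01.1.le, le_rfl⟩
  have hlim : Tendsto g (𝓝[Set.Ioo 0 u] u) (𝓝 (g u)) :=
    hcont.mono fun v hv => ⟨hv.1, hv.2.le.trans hu01.2⟩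
  exact le_of_tendsto hlim (eventually_mem_nhdsWithin.mono hlow)

theorem IsDistortionWeight.abs_le {γ : ℝ → ℝ} (hγ : IsDistortionWeight γ) {u : ℝ}
    (hu : u ∈ Set.Ioc (0 : ℝ) 1) : |γ u| ≤ γ 1 := by
  have hu' : u ∈ Set.Icc (0 : ℝ) 1 := Set.Ioc_subset_Icc_self hu
  rw [abs_of_nonneg (hγ.nonneg u hu')]
  exact hγ.mono hu' (Set.right_mem_Icc.2 zero_le_one) hu.2

theorem IsDistortionWeight.monotoneOn {γ : ℝ → ℝ} (hγ : IsDistortionWeight γ) :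
    MonotoneOn γ (Set.Ioc 0 1) := hγ.mono.mono Set.Ioc_subset_Icc_self

theorem IsDistortionWeight.memLp {γ : ℝ → ℝ} (hγ : IsDistortionWeight γ) :
    MemLp γ 2 unitVolume :=
  memLp_of_monotoneOn_of_bounded hγ.monotoneOn fun _ hu => hγ.abs_le hu

/-- The constant function `1` in `L²([0,1])`. -/
noncomputable def oneL2 : Lp ℝ 2 unitVolume := (memLp_const (1 : ℝ)).toLp (fun _ => (1 : ℝ))

theorem coeFn_oneL2 : oneL2 =ᵐ[unitVolume] (1 : ℝ → ℝ) := MemLp.coeFn_toLp _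

theorem inner_oneL2_self : inner ℝ oneL2 oneL2 = 1 := by
  rw [← ip_eq_inner coeFn_oneL2 coeFn_oneL2]
  simp [ip]

theorem IsDistortionWeight.inner_oneL2 {γ : ℝ → ℝ} (hγ : IsDistortionWeight γ)
    {G : Lp ℝ 2 unitVolume} (hG : G =ᵐ[unitVolume] γ) : inner ℝ G oneL2 = 1 := by
  rw [← ip_eq_inner hG coeFn_oneL2]
  simpa [ip] using hγ.integral_eq_one

section Moments

variable {ν : Measure ℝ} {γ : ℝ → ℝ} {F G : Lp ℝ 2 unitVolume}

theorem lawMean_eq_inner (hF : F =ᵐ[unitVolume] quantile ν) : lawMean ν = inner ℝ F oneL2 :=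
  ip_eq_inner hF coeFn_oneL2

theorem lawVar_eq_inner (hF : F =ᵐ[unitVolume] quantile ν) :
    lawVar ν = inner ℝ F F - inner ℝ F oneL2 ^ 2 := by
  rw [lawVar, lawMean_eq_inner hF, l2norm_eq_norm hF, real_inner_self_eq_norm_sq]

theorem weightVar_eq_inner (hG : G =ᵐ[unitVolume] γ) : weightVar γ = inner ℝ G G - 1 := by
  rw [weightVar, l2norm_eq_norm hG, real_inner_self_eq_norm_sq]

theorem lawCov_eq_inner (hF : F =ᵐ[unitVolume] quantile ν) (hG : G =ᵐ[unitVolume] γ) :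
    lawCov γ ν = inner ℝ F G - inner ℝ F oneL2 := by
  rw [lawCov, lawMean_eq_inner hF, ip_eq_inner hF hG]

end Moments

theorem distortionRisk_eq (γ : ℝ → ℝ) (ν : Measure ℝ) :
    distortionRisk γ ν = lawMean ν + lawCov γ ν := by
  rw [distortionRisk, lawCov, ip_comm]
  ring

/-! ### The worst case over the uncertainty set -/

section Hilbert

variable {E : Type*} [NormedAddCommGroup E] [InnerProductSpace ℝ E]

/-- Weak duality for the problem of maximizing `⟪γ, g⟫` among the vectors `g` with prescribed
`⟪g, o⟫` and norm and with a lower bound on `⟪q, g⟫`. -/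
theorem inner_le_of_lagrangian {o γ q g : E} (ho : inner ℝ o o = 1) (hγ : inner ℝ γ o = 1)
    {s k G K l b : ℝ} (hs : s = inner ℝ q q - inner ℝ q o ^ 2) (hk : k = inner ℝ q γ - inner ℝ q o)
    (hG : G = inner ℝ γ γ - 1) (hl : 0 ≤ l) (hb : 0 < b)
    (hsb : s * b ^ 2 = G + 2 * l * k + l ^ 2 * s)
    (hgo : inner ℝ g o = inner ℝ q o) (hgg : inner ℝ g g = inner ℝ q q)
    (hK : K ≤ inner ℝ q g - inner ℝ q o ^ 2) :
    inner ℝ γ g ≤ inner ℝ q o + s * b - l * K := by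
  -- By `hsb`, both `γ - o + l (q - m o)` and `b (g - m o)` have squared norm `s b²`, where `m = ⟪q,
  -- o⟫`. Nonnegativity of the squared norm of their difference bounds the cross term, which is the
  -- Lagrangian.
  have h0 : 0 ≤ inner ℝ (γ - o + l • (q - inner ℝ q o • o) - b • (g - inner ℝ q o • o))
      (γ - o + l • (q - inner ℝ q o • o) - b • (g - inner ℝ q o • o)) := real_inner_self_nonneg
  simp only [inner_sub_left, inner_sub_right, inner_add_left, inner_add_right,
    real_inner_smul_left, real_inner_smul_right, ho, real_inner_comm γ o, real_inner_comm q o,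
    real_inner_comm g o, hγ, hgo, hgg, real_inner_comm q γ, real_inner_comm γ g,
    real_inner_comm q g] at h0
  have h1 : 0 ≤ 2 * b * (inner ℝ q o + s * b
      - l * (inner ℝ q g - inner ℝ q o ^ 2) - inner ℝ γ g) := by
    subst hs hk hG
    linarith
  have h2 := nonneg_of_mul_nonneg_right h1 (by positivity)
  linarith [mul_le_mul_of_nonneg_left hK hl]

variable {o γ q g : E} {m s k G K l b : ℝ}

/-- The primal solution of the problem of `inner_le_of_lagrangian`. -/
theorem inner_primal (ho : inner ℝ o o = 1) (hγ : inner ℝ γ o = 1)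
    (hm : m = inner ℝ q o) (hs : s = inner ℝ q q - m ^ 2) (hk : k = inner ℝ q γ - m)
    (hG : G = inner ℝ γ γ - 1) (hb : 0 < b)
    (hsb : s * b ^ 2 = G + 2 * l * k + l ^ 2 * s)
    (hg : g = m • o + b⁻¹ • (γ - o + l • (q - m • o))) :
    inner ℝ g o = m ∧ inner ℝ g g = inner ℝ q q ∧
      inner ℝ q g = m ^ 2 + b⁻¹ * (k + l * s) ∧ inner ℝ γ g = m + b⁻¹ * (G + l * k) := by
  have hqo : inner ℝ q o = m := hm.symm
  subst hg
  simp only [inner_sub_left, inner_sub_right, inner_add_left, inner_add_right,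
    real_inner_smul_left, real_inner_smul_right, ho, real_inner_comm γ o, real_inner_comm q o,
    hγ, hqo, real_inner_comm q γ]
  have hγγ : inner ℝ γ γ = G + 1 := by linarith
  have hqγ : inner ℝ q γ = k + m := by linarith
  have hqq : inner ℝ q q = s + m ^ 2 := by linarith
  rw [hγγ, hqγ, hqq]
  have h1 : b⁻¹ ^ 2 * (G + 2 * l * k + l ^ 2 * s) = s := by
    rw [← hsb]
    field_simp
  refine ⟨by ring, ?_, by ring, by ring⟩
  linear_combination h1

end Hilbert

/-- The robust risk measure in terms of a solution `(l, b)` of the Karush-Kuhn-Tucker system. -/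
theorem robustRisk_eq_of_kkt {γ : ℝ → ℝ} {ν : Measure ℝ} (hγ : IsDistortionWeight γ)
    (hν : IsBoundedLaw ν) {e : ℝ≥0} {l b : ℝ} (hl : 0 ≤ l) (hb : 0 < b)
    (hsb : lawVar ν * b ^ 2 = weightVar γ + 2 * l * lawCov γ ν + l ^ 2 * lawVar ν)
    (hfeas : constK e ν * b ≤ lawCov γ ν + l * lawVar ν)
    (hcompl : l * (lawCov γ ν + l * lawVar ν - constK e ν * b) = 0) :
    robustRisk e γ ν = lawMean ν + lawVar ν * b - l * constK e ν := by
  have hF := hν.memLp_quantile.coeFn_toLp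
  have hG := hγ.memLp.coeFn_toLp
  set F := hν.memLp_quantile.toLp (quantile ν)
  set G := hγ.memLp.toLp γ
  have hm := lawMean_eq_inner hF
  have hs := lawVar_eq_inner hF
  have hk := lawCov_eq_inner hF hG
  have hw := weightVar_eq_inner hG
  have hGo := hγ.inner_oneL2 hG
  have hK : constK e ν = lawVar ν - (e : ℝ) ^ 2 / 2 := rfl
  refine IsGreatest.csSup_eq ⟨?_, ?_⟩
  · obtain ⟨hp, C, hC⟩ := id hν
    -- The pointwise form of the primal solution; monotonicity uses `0 ≤ l` and `0 < b`.
    set g : ℝ → ℝ := fun u =>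
      lawMean ν + b⁻¹ * (γ u - 1 + l * (quantile ν u - lawMean ν)) with hg
    have hmono : MonotoneOn g (Set.Ioc 0 1) := by
      intro u hu v hv huv
      have h1 := hγ.monotoneOn hu hv huv
      have h2 := monotoneOn_quantile hC hu hv huv
      simp only [hg]
      gcongr
    have hbd : ∀ u ∈ Set.Ioc (0 : ℝ) 1, |g u| ≤ |lawMean ν| +
        b⁻¹ * (γ 1 + 1 + l * (C + |lawMean ν|)) := by
      intro u hu
      have h1 := hγ.abs_le hu
      have h2 := abs_quantile_le hC hu
      calc |g u| ≤ |lawMean ν| + |b⁻¹ * (γ u - 1 + l * (quantile ν u - lawMean ν))| :=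
            abs_add_le _ _
        _ ≤ |lawMean ν| + b⁻¹ * (γ 1 + 1 + l * (C + |lawMean ν|)) := by
            rw [abs_mul, abs_of_pos (inv_pos.2 hb)]
            gcongr
            refine (abs_add_le _ _).trans (add_le_add ((abs_sub _ _).trans ?_) ?_)
            · simpa using h1
            · rw [abs_mul, abs_of_nonneg hl]
              gcongr
              exact (abs_sub _ _).trans (by gcongr)
    set H : Lp ℝ 2 unitVolume :=
      lawMean ν • oneL2 + b⁻¹ • (G - oneL2 + l • (F - lawMean ν • oneL2)) with hH
    have hHg : H =ᵐ[unitVolume] g := by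
      filter_upwards [hF, hG, coeFn_oneL2,
        Lp.coeFn_add (lawMean ν • oneL2) (b⁻¹ • (G - oneL2 + l • (F - lawMean ν • oneL2))),
        Lp.coeFn_smul (lawMean ν) oneL2,
        Lp.coeFn_smul b⁻¹ (G - oneL2 + l • (F - lawMean ν • oneL2)),
        Lp.coeFn_add (G - oneL2) (l • (F - lawMean ν • oneL2)), Lp.coeFn_sub G oneL2,
        Lp.coeFn_smul l (F - lawMean ν • oneL2), Lp.coeFn_sub F (lawMean ν • oneL2)]
        with u h1 h2 h3 h4 h5 h6 h7 h8 h9 h10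
      simp only [hH, hg, h4, Pi.add_apply, h5, Pi.smul_apply, h6, h7, h8, Pi.sub_apply, h9, h10,
        h1, h2, h3, Pi.one_apply, smul_eq_mul, mul_one]
    have hHq : H =ᵐ[unitVolume] quantile (unitVolume.map g) :=
      hHg.trans (quantile_map_unitVolume hmono hbd).symm
    obtain ⟨h1, h2, h3, h4⟩ :=
      inner_primal inner_oneL2_self hGo hm (by rw [hs, hm]) (by rw [hk, hm]) hw hb hsb hH
    refine ⟨unitVolume.map g, ⟨IsBoundedLaw.map_unitVolume hmono hbd, ?_, ?_, ?_⟩, ?_⟩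
    · refine abs_le_of_sq_le_sq' ?_ e.2 |>.2
      rw [l2norm_sub_sq hF hHq, h2, h3]
      -- The right-hand side is the covariance of `F` and `H`; as their norms agree, this inequality
      -- is the distance constraint.
      have h5 : constK e ν ≤ b⁻¹ * (lawCov γ ν + l * lawVar ν) := by
        rw [inv_mul_eq_div, le_div_iff₀ hb]
        exact hfeas
      have h6 : inner ℝ F F = lawVar ν + lawMean ν ^ 2 := by rw [hs, hm]; ring
      change _ ≤ (e : ℝ) ^ 2
      linarith
    · rw [ip_eq_inner hHq coeFn_oneL2, h1, lawMean]
    · rw [l2norm_eq_norm hF, l2norm_eq_norm hHq, ← real_inner_self_eq_norm_sq,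
        ← real_inner_self_eq_norm_sq, h2]
    · rw [distortionRisk, ip_eq_inner hG hHq, h4]
      field_simp
      linear_combination -hcompl - hsb
  · rintro _ ⟨ν', ⟨hν', hd, hmean, hnorm⟩, rfl⟩
    have hH := hν'.memLp_quantile.coeFn_toLp
    set H := hν'.memLp_quantile.toLp (quantile ν')
    rw [ip_eq_inner hF coeFn_oneL2, ip_eq_inner hH coeFn_oneL2] at hmean
    rw [l2norm_eq_norm hF, l2norm_eq_norm hH, ← real_inner_self_eq_norm_sq,
      ← real_inner_self_eq_norm_sq] at hnorm
    have hd2 := pow_le_pow_left₀ (Real.sqrt_nonneg _) hd 2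
    rw [← l2norm, l2norm_sub_sq hF hH] at hd2
    rw [distortionRisk, ip_eq_inner hG hH, hm]
    exact inner_le_of_lagrangian inner_oneL2_self hGo hs hk hw hl hb hsb hmean.symm hnorm.symm
      (by rw [hK, hs]; linarith)

theorem self_mem_uncertaintySet {ν : Measure ℝ} (hν : IsBoundedLaw ν) (e : ℝ≥0) :
    ν ∈ uncertaintySet e ν :=
  ⟨hν, by simp [l2norm, ip], rfl, rfl⟩

/-- Without tolerance the robust risk measure is the distortion risk measure. -/
theorem robustRisk_zero {γ : ℝ → ℝ} {ν : Measure ℝ} (hγ : IsDistortionWeight γ)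
    (hν : IsBoundedLaw ν) : robustRisk 0 γ ν = lawMean ν + lawCov γ ν := by
  rw [← distortionRisk_eq]
  refine IsGreatest.csSup_eq ⟨⟨ν, self_mem_uncertaintySet hν 0, rfl⟩, ?_⟩
  rintro _ ⟨ν', ⟨hν', hd, -, -⟩, rfl⟩
  have hF := hν.memLp_quantile.coeFn_toLp
  have hG := hγ.memLp.coeFn_toLp
  have hH := hν'.memLp_quantile.coeFn_toLp
  rw [l2norm_sub hF hH, NNReal.coe_zero, norm_le_zero_iff, sub_eq_zero] at hd
  rw [distortionRisk, distortionRisk, ip_eq_inner hG hF, ip_eq_inner hG hH, hd]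

/-- A constant weight yields the mean, for every tolerance. -/
theorem robustRisk_of_weightVar_eq_zero {γ : ℝ → ℝ} {ν : Measure ℝ} (hγ : IsDistortionWeight γ)
    (hν : IsBoundedLaw ν) (hw : weightVar γ = 0) (e : ℝ≥0) : robustRisk e γ ν = lawMean ν := by
  have hG := hγ.memLp.coeFn_toLp
  have hGo := hγ.inner_oneL2 hG
  -- Here `‖γ - 1‖² = ‖γ‖² - 1 = 0`.
  have hGone : hγ.memLp.toLp γ = oneL2 := by
    rw [weightVar_eq_inner hG] at hw
    rw [← sub_eq_zero, ← inner_self_eq_zero (𝕜 := ℝ)]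
    simp only [inner_sub_left, inner_sub_right, real_inner_comm (hγ.memLp.toLp γ) oneL2, hGo,
      inner_oneL2_self]
    linarith
  have hmean : ∀ {ν'}, IsBoundedLaw ν' → distortionRisk γ ν' = lawMean ν' := by
    intro ν' hν'
    have hH := hν'.memLp_quantile.coeFn_toLp
    rw [lawMean_eq_inner hH, distortionRisk, ip_eq_inner hG hH, hGone, real_inner_comm]
  refine IsGreatest.csSup_eq ⟨⟨ν, self_mem_uncertaintySet hν e, hmean hν⟩, ?_⟩
  rintro _ ⟨ν', ⟨hν', -, h, -⟩, rfl⟩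
  exact ((hmean hν').trans h.symm).le

/-- Cauchy-Schwarz for the centred functions `F - μ` and `γ - 1`. -/
theorem lawCov_sq_le {γ : ℝ → ℝ} {ν : Measure ℝ} (hγ : IsDistortionWeight γ)
    (hν : IsBoundedLaw ν) : lawCov γ ν ^ 2 ≤ lawVar ν * weightVar γ := by
  have hF := hν.memLp_quantile.coeFn_toLp
  have hG := hγ.memLp.coeFn_toLp
  have hGo := hγ.inner_oneL2 hG
  rw [lawCov_eq_inner hF hG, lawVar_eq_inner hF, weightVar_eq_inner hG]
  set F := hν.memLp_quantile.toLp (quantile ν)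
  set G := hγ.memLp.toLp γ
  have h := real_inner_mul_inner_self_le (F - inner ℝ F oneL2 • oneL2) (G - oneL2)
  simp only [inner_sub_left, inner_sub_right, real_inner_smul_left, real_inner_smul_right,
    real_inner_comm G oneL2, real_inner_comm F oneL2, hGo, inner_oneL2_self] at h
  linarith

theorem weightVar_nonneg {γ : ℝ → ℝ} (hγ : IsDistortionWeight γ) : 0 ≤ weightVar γ := by
  have hG := hγ.memLp.coeFn_toLp
  have hGo := hγ.inner_oneL2 hG
  rw [weightVar_eq_inner hG]
  have h : 0 ≤ inner ℝ (hγ.memLp.toLp γ - oneL2) (hγ.memLp.toLp γ - oneL2) :=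
    real_inner_self_nonneg
  simp only [inner_sub_left, inner_sub_right, real_inner_comm (hγ.memLp.toLp γ) oneL2, hGo,
    inner_oneL2_self] at h
  linarith

/-- Chebyshev's integral inequality for the quantile function and the weight. -/
theorem lawCov_nonneg {γ : ℝ → ℝ} {ν : Measure ℝ} (hγ : IsDistortionWeight γ)
    (hν : IsBoundedLaw ν) : 0 ≤ lawCov γ ν := by
  have hq := hν.memLp_quantile
  obtain ⟨hp, C, hC⟩ := hν
  have hmono := monotoneOn_quantile hC
  set m := lawMean ν with hm
  -- The supremum `v` of `D` is the point where the quantile function crosses its mean, so `quantile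
  -- ν u - m` and `γ u - γ v` never have opposite signs. Their product integrates to the covariance.
  -- Inserting `0` keeps `D` nonempty.
  set D : Set ℝ := insert 0 {u ∈ Set.Ioc (0 : ℝ) 1 | quantile ν u ≤ m}
  have hD : ∀ u ∈ D, u ∈ Set.Icc (0 : ℝ) 1 := by
    rintro u (rfl | hu)
    · simp
    · exact Set.Ioc_subset_Icc_self hu.1
  have hDb : BddAbove D := ⟨1, fun u hu => (hD u hu).2⟩
  set v := sSup D
  have hv : v ∈ Set.Icc (0 : ℝ) 1 :=
    ⟨le_csSup hDb (Set.mem_insert _ _), csSup_le ⟨0, Set.mem_insert _ _⟩ fun u hu => (hD u hu).2⟩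
  have hpt : ∀ u ∈ Set.Ioc (0 : ℝ) 1, 0 ≤ (quantile ν u - m) * (γ u - γ v) := by
    intro u hu
    have hu' := Set.Ioc_subset_Icc_self hu
    rcases lt_trichotomy u v with h | h | h
    · obtain ⟨w, hw, huw⟩ := exists_lt_of_lt_csSup ⟨0, Set.mem_insert _ _⟩ h
      rcases hw with rfl | hw
      · exact absurd hu.1 huw.not_gt
      · exact mul_nonneg_of_nonpos_of_nonpos
          (sub_nonpos.2 ((hmono hu hw.1 huw.le).trans hw.2)) (sub_nonpos.2 (hγ.mono hu' hv h.le))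
    · simp [h]
    · refine mul_nonneg (sub_nonneg.2 ?_) (sub_nonneg.2 (hγ.mono hv hu' h.le))
      by_contra! hlt
      exact h.not_ge (le_csSup hDb (Set.mem_insert_of_mem _ ⟨hu, hlt.le⟩))
  have hint : 0 ≤ ∫ u, (quantile ν u - m) * (γ u - γ v) ∂unitVolume := by
    refine integral_nonneg_of_ae ?_
    filter_upwards [ae_restrict_mem measurableSet_Ioc] with u hu using hpt u hu
  have hqi : Integrable (quantile ν) unitVolume := hq.integrable (by norm_num)
  have hγi : Integrable γ unitVolume := hγ.memLp.integrable (by norm_num)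
  have hqγ : Integrable (fun u => quantile ν u * γ u) unitVolume := hq.integrable_mul hγ.memLp
  have e1 : ∫ u, quantile ν u ∂unitVolume = m := by
    simp [hm, lawMean, ip, intervalIntegral.integral_of_le]
  have e2 : ∫ u, γ u ∂unitVolume = 1 := by
    rw [← hγ.integral_eq_one, intervalIntegral.integral_of_le zero_le_one]
  have e3 : ∫ u, quantile ν u * γ u ∂unitVolume = lawCov γ ν + m := by
    simp [hm, lawCov, ip, intervalIntegral.integral_of_le]
  have hexp : ∀ u, (quantile ν u - m) * (γ u - γ v) =
      quantile ν u * γ u - γ v * quantile ν u - m * γ u + m * γ v := fun u => by ring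
  simp only [hexp] at hint
  have i1 : Integrable (fun u => γ v * quantile ν u) unitVolume := hqi.const_mul _
  have i2 : Integrable (fun u => m * γ u) unitVolume := hγi.const_mul _
  have i3 : Integrable (fun u => quantile ν u * γ u - γ v * quantile ν u) unitVolume := hqγ.sub i1
  have i4 : Integrable (fun u => quantile ν u * γ u - γ v * quantile ν u - m * γ u) unitVolume :=
    i3.sub i2
  rw [integral_add i4 (integrable_const _), integral_sub i3 i2, integral_sub hqγ i1,
    integral_const_mul, integral_const_mul, e1, e2, e3] at hint
  simp at hint
  linarith

/-! ### Closed forms of the robust risk measure -/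

/-- The closed form when the distance constraint is binding. -/
theorem robustRisk_eq_of_binding {γ : ℝ → ℝ} {ν : Measure ℝ} (hγ : IsDistortionWeight γ)
    (hν : IsBoundedLaw ν) {e : ℝ≥0} (he : 0 < e) (hs : 0 < lawVar ν) (hK : 0 < constK e ν)
    (hW : 0 < weightVar γ * lawVar ν - lawCov γ ν ^ 2)
    (hbind : lawCov γ ν ^ 2 * (lawVar ν ^ 2 - constK e ν ^ 2) ≤
      constK e ν ^ 2 * (weightVar γ * lawVar ν - lawCov γ ν ^ 2)) :
    robustRisk e γ ν = lawMean ν + lawCov γ ν - (e : ℝ) ^ 2 / 2 * (lawCov γ ν / lawVar ν) +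
      e * (√((weightVar γ * lawVar ν - lawCov γ ν ^ 2) * (lawVar ν - (e : ℝ) ^ 2 / 4))
        / lawVar ν) := by
  have he' : (0 : ℝ) < e := he
  have hKdef : constK e ν = lawVar ν - (e : ℝ) ^ 2 / 2 := rfl
  have hr : 0 < lawVar ν - (e : ℝ) ^ 2 / 4 := by
    have : 0 < (e : ℝ) ^ 2 := by positivity
    linarith
  rw [Real.sqrt_mul hW.le]
  set K := constK e ν
  set s := lawVar ν
  set k := lawCov γ ν
  set r := √(s - (e : ℝ) ^ 2 / 4)
  set w := √(weightVar γ * s - k ^ 2)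
  have hr0 : 0 < r := Real.sqrt_pos.2 hr
  have hw0 : 0 < w := Real.sqrt_pos.2 hW
  have hr2 : r ^ 2 = s - (e : ℝ) ^ 2 / 4 := Real.sq_sqrt hr.le
  have hw2 : w ^ 2 = weightVar γ * s - k ^ 2 := Real.sq_sqrt hW.le
  have hsK : s ^ 2 - K ^ 2 = (e * r) ^ 2 := by
    rw [mul_pow, hr2, hKdef]
    ring
  have hkb : k ≤ K * (w / (e * r)) := by
    rw [← mul_div_assoc, le_div_iff₀ (by positivity)]
    refine le_of_abs_le (abs_le_of_sq_le_sq ?_ (by positivity))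
    rw [mul_pow, mul_pow K w, hw2, ← hsK]
    exact hbind
  -- The binding constraint `k + l s = K b` gives `l = (K b - k) / s`; inserted into the
  -- normalization of `b`, it yields `b² (s² - K²) = w²`, where `s² - K² = (e r)²`. The hypothesis
  -- `hbind` then amounts to `l ≥ 0`. These are the multipliers `lamStar` and `bStar`.
  set b := w / (e * r) with hb
  have hb0 : 0 < b := by positivity
  have hber : b * (e * r) = w := by rw [hb]; field_simp
  have hb2 : b ^ 2 * (s ^ 2 - K ^ 2) = weightVar γ * s - k ^ 2 := by
    rw [hsK, ← hw2, ← hber]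
    ring
  have hls : (K * b - k) / s * s = K * b - k := by field_simp
  rw [robustRisk_eq_of_kkt hγ hν (l := (K * b - k) / s) (b := b)
    (div_nonneg (sub_nonneg.2 hkb) hs.le) hb0]
  · have h1 : s * (s * b) - (K * b - k) * K = K * k + e * (w * r) := by
      have : b * (e * r) ^ 2 = w * (e * r) := by rw [← hber]; ring
      rw [← hsK] at this
      linear_combination this
    have he2 : (e : ℝ) ^ 2 / 2 = s - K := by rw [hKdef]; ring
    change lawMean ν + s * b - (K * b - k) / s * K =
      lawMean ν + k - (e : ℝ) ^ 2 / 2 * (k / s) + e * (w * r / s)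
    rw [he2]
    clear_value b
    field_simp
    linear_combination h1
  · change s * b ^ 2 = weightVar γ + 2 * ((K * b - k) / s) * k + ((K * b - k) / s) ^ 2 * s
    field_simp
    linear_combination hb2
  · change K * b ≤ k + (K * b - k) / s * s
    rw [hls]
    linarith
  · change (K * b - k) / s * (k + (K * b - k) / s * s - K * b) = 0
    rw [hls]
    ring

/-- The closed form when the distance constraint is not binding. -/
theorem robustRisk_eq_of_not_binding {γ : ℝ → ℝ} {ν : Measure ℝ} (hγ : IsDistortionWeight γ)
    (hν : IsBoundedLaw ν) {e : ℝ≥0} (hs : 0 < lawVar ν) (hG : 0 < weightVar γ)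
    (hfree : constK e ν * (√(weightVar γ) / √(lawVar ν)) ≤ lawCov γ ν) :
    robustRisk e γ ν = lawMean ν + √(lawVar ν) * √(weightVar γ) := by
  have h1 : lawVar ν = √(lawVar ν) ^ 2 := (Real.sq_sqrt hs.le).symm
  have h0 := Real.sqrt_pos.2 hs
  -- A slack constraint has multiplier `0`, and the normalization becomes `s b² = G`.
  rw [robustRisk_eq_of_kkt hγ hν (l := 0) (b := √(weightVar γ) / √(lawVar ν)) le_rfl
    (by positivity)]
  · have h2 : lawVar ν * (√(weightVar γ) / √(lawVar ν)) = √(lawVar ν) * √(weightVar γ) := by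
      nth_rw 1 [h1]
      field_simp
    rw [zero_mul, sub_zero, h2]
  · rw [div_pow, Real.sq_sqrt hs.le, Real.sq_sqrt hG.le]
    field_simp
    ring
  · simpa using hfree
  · ring

/-! ### Differentiability -/

section Differentiability

variable {X : Type*} [NormedAddCommGroup X] [NormedSpace ℝ X]

/-- At `e = 0` the radicand is `(G s - k²) s > 0`, so the square root stays differentiable for small
`e`, and the factors `e` and `e²` remove the correction terms in the limit. -/
theorem differentiableAt_binding_formula {m s k : X → ℝ} {x₀ : X} (hm : DifferentiableAt ℝ m x₀)
    (hs : DifferentiableAt ℝ s x₀) (hk : DifferentiableAt ℝ k x₀) (hs0 : 0 < s x₀) {G : ℝ}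
    (hW : 0 < G * s x₀ - k x₀ ^ 2) :
    (∀ᶠ e in 𝓝 (0 : ℝ), DifferentiableAt ℝ (fun x => m x + k x - e ^ 2 / 2 * (k x / s x) +
      e * (√((G * s x - k x ^ 2) * (s x - e ^ 2 / 4)) / s x)) x₀) ∧
    Tendsto (fun e : ℝ => fderiv ℝ (fun x => m x + k x - e ^ 2 / 2 * (k x / s x) +
      e * (√((G * s x - k x ^ 2) * (s x - e ^ 2 / 4)) / s x)) x₀) (𝓝 0)
      (𝓝 (fderiv ℝ (fun x => m x + k x) x₀)) := by
  have hmk : HasFDerivAt (fun x => m x + k x) (fderiv ℝ (fun x => m x + k x) x₀) x₀ :=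
    (hm.add hk).hasFDerivAt
  obtain ⟨D, hD⟩ : DifferentiableAt ℝ (fun x => k x / s x) x₀ := by
    fun_prop (disch := exact hs0.ne')
  obtain ⟨J, hJ⟩ : DifferentiableAt ℝ (fun x => (s x)⁻¹) x₀ := hs.inv hs0.ne'
  obtain ⟨W', hW'⟩ : DifferentiableAt ℝ (fun x => G * s x - k x ^ 2) x₀ := by fun_prop
  obtain ⟨P', hP'⟩ : DifferentiableAt ℝ (fun x => (G * s x - k x ^ 2) * s x) x₀ := by fun_prop
  set L := fderiv ℝ (fun x => m x + k x) x₀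
  let T : ℝ → ℝ := fun e => (G * s x₀ - k x₀ ^ 2) * (s x₀ - e ^ 2 / 4)
  have hpos : ∀ᶠ e in 𝓝 (0 : ℝ), 0 < s x₀ - e ^ 2 / 4 := by
    have : ContinuousAt (fun e : ℝ => s x₀ - e ^ 2 / 4) 0 := by fun_prop
    exact this.eventually (lt_mem_nhds (by simpa using hs0))
  have hder : ∀ᶠ e in 𝓝 (0 : ℝ), HasFDerivAt (fun x => m x + k x - e ^ 2 / 2 * (k x / s x) +
      e * (√((G * s x - k x ^ 2) * (s x - e ^ 2 / 4)) / s x))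
      (L - (e ^ 2 / 2) • D + e • (√(T e) • J +
        (s x₀)⁻¹ • ((1 / (2 * √(T e))) • (P' - (e ^ 2 / 4) • W')))) x₀ := by
    filter_upwards [hpos] with e he
    -- Expanding the product leaves `e` only in scalar coefficients of the fixed derivatives `P'`
    -- and `W'`, so continuity in `e` is immediate.
    have hT : HasFDerivAt (fun x => (G * s x - k x ^ 2) * (s x - e ^ 2 / 4))
        (P' - (e ^ 2 / 4) • W') x₀ := by
      refine (hP'.sub (hW'.const_mul (e ^ 2 / 4))).congr_of_eventuallyEq (.of_forall fun x => ?_)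
      simp only [Pi.sub_apply]
      ring
    simp only [div_eq_mul_inv (√_)]
    exact (hmk.sub (hD.const_mul _)).add (((hT.sqrt (mul_pos hW he).ne').mul hJ).const_mul e)
  refine ⟨hder.mono fun e he => he.differentiableAt, ?_⟩
  refine Tendsto.congr' (hder.mono fun e he => he.fderiv.symm) ?_
  have hT0 : √(T 0) ≠ 0 := (Real.sqrt_pos.2 (mul_pos hW hpos.self_of_nhds)).ne'
  have hTc : ContinuousAt T 0 := by fun_prop
  have hinv : ContinuousAt (fun e => 1 / (2 * √(T e))) 0 :=
    continuousAt_const.div (continuousAt_const.mul hTc.sqrt) (mul_ne_zero two_ne_zero hT0)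
  have hc : ContinuousAt (fun e : ℝ => L - (e ^ 2 / 2) • D + e • (√(T e) • J +
        (s x₀)⁻¹ • ((1 / (2 * √(T e))) • (P' - (e ^ 2 / 4) • W')))) 0 := by
    fun_prop
  simpa [ContinuousAt] using hc

theorem tendsto_coe_nhdsGT_zero : Tendsto (fun e : ℝ≥0 => (e : ℝ)) (𝓝[>] 0) (𝓝 0) :=
  (NNReal.continuous_coe.tendsto' 0 0 rfl).mono_left nhdsWithin_le_nhds

theorem differentiableAt_moments {law : X → Measure ℝ} {x₀ : X} {γ : ℝ → ℝ}
    (hγ : IsDistortionWeight γ) (hd : L2QuantileDifferentiableAt law x₀) :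
    DifferentiableAt ℝ (fun x => lawMean (law x)) x₀ ∧
    DifferentiableAt ℝ (fun x => lawVar (law x)) x₀ ∧
    DifferentiableAt ℝ (fun x => lawCov γ (law x)) x₀ := by
  obtain ⟨Φ, hΦ, hd⟩ := hd
  have hG := hγ.memLp.coeFn_toLp
  refine ⟨DifferentiableAt.congr_of_eventuallyEq (f := fun x => inner ℝ (Φ x) oneL2) ?_
      (hΦ.mono fun x hx => lawMean_eq_inner hx),
    DifferentiableAt.congr_of_eventuallyEq
      (f := fun x => inner ℝ (Φ x) (Φ x) - inner ℝ (Φ x) oneL2 ^ 2) ?_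
      (hΦ.mono fun x hx => lawVar_eq_inner hx),
    DifferentiableAt.congr_of_eventuallyEq
      (f := fun x => inner ℝ (Φ x) (hγ.memLp.toLp γ) - inner ℝ (Φ x) oneL2) ?_
      (hΦ.mono fun x hx => lawCov_eq_inner hx hG)⟩
  · exact hd.inner ℝ (differentiableAt_const _)
  · exact (hd.inner ℝ hd).sub ((hd.inner ℝ (differentiableAt_const _)).pow 2)
  · exact (hd.inner ℝ (differentiableAt_const _)).sub (hd.inner ℝ (differentiableAt_const _))

theorem tendsto_fderiv_comp {ι Y : Type*} [NormedAddCommGroup Y] [NormedSpace ℝ Y] {l : Filter ι}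
    {g : ι → Y → ℝ} {f : X → Y} {x₀ : X} {L : Y →L[ℝ] ℝ} (hf : DifferentiableAt ℝ f x₀)
    (hg : ∀ᶠ i in l, DifferentiableAt ℝ (g i) (f x₀))
    (hL : Tendsto (fun i => fderiv ℝ (g i) (f x₀)) l (𝓝 L)) :
    (∀ᶠ i in l, DifferentiableAt ℝ (fun x => g i (f x)) x₀) ∧
    Tendsto (fun i => fderiv ℝ (fun x => g i (f x)) x₀) l (𝓝 (L.comp (fderiv ℝ f x₀))) := by
  refine ⟨hg.mono fun i hi => hi.comp x₀ hf, ?_⟩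
  have hc : Continuous fun L : Y →L[ℝ] ℝ => L.comp (fderiv ℝ f x₀) := by fun_prop
  refine ((hc.tendsto L).comp hL).congr' (hg.mono fun i hi => ?_)
  exact (fderiv_comp x₀ hi hf).symm

/-- The total derivative of a function of two variables along a curve. -/
theorem fderiv_comp_prodMk {A : Type*} [NormedAddCommGroup A] [NormedSpace ℝ A]
    {g : A × X → ℝ} {f : X → A} {x₀ : X} (hf : DifferentiableAt ℝ f x₀)
    (hg : DifferentiableAt ℝ g (f x₀, x₀)) :
    DifferentiableAt ℝ (fun x => g (f x₀, x)) x₀ ∧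
    (fderiv ℝ g (f x₀, x₀)).comp (fderiv ℝ (fun x => (f x, x)) x₀) =
      (fderiv ℝ (fun a => g (a, x₀)) (f x₀)).comp (fderiv ℝ f x₀) +
        fderiv ℝ (fun x => g (f x₀, x)) x₀ := by
  have k1 : HasFDerivAt (fun x => g (f x₀, x)) _ x₀ :=
    hg.hasFDerivAt.comp x₀ (hasFDerivAt_prodMk_right (f x₀) x₀)
  have k2 : HasFDerivAt (fun a => g (a, x₀)) _ (f x₀) :=
    hg.hasFDerivAt.comp (f x₀) (hasFDerivAt_prodMk_left (f x₀) x₀)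
  refine ⟨k1.differentiableAt, ?_⟩
  have k3 : HasFDerivAt (fun x => (f x, x)) _ x₀ := hf.hasFDerivAt.prodMk (hasFDerivAt_id x₀)
  rw [k1.fderiv, k2.fderiv, k3.fderiv]
  ext v
  simp [← map_add]

/-- The robust risk measure of a differentiable family of laws is differentiable for small
tolerances, and its derivative converges to the one of the distortion risk measure. -/
theorem tendsto_fderiv_robustRisk {law : X → Measure ℝ} {x₀ : X} {γ : ℝ → ℝ}
    (hγ : IsDistortionWeight γ) (hb : ∀ᶠ x in 𝓝 x₀, IsBoundedLaw (law x))
    (hd : L2QuantileDifferentiableAt law x₀) (hv : 0 < lawVar (law x₀)) :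
    DifferentiableAt ℝ (fun x => robustRisk 0 γ (law x)) x₀ ∧
    (∀ᶠ e in 𝓝[>] (0 : ℝ≥0), DifferentiableAt ℝ (fun x => robustRisk e γ (law x)) x₀) ∧
    Tendsto (fun e : ℝ≥0 => fderiv ℝ (fun x => robustRisk e γ (law x)) x₀) (𝓝[>] 0)
      (𝓝 (fderiv ℝ (fun x => robustRisk 0 γ (law x)) x₀)) := by
  obtain ⟨hm, hs, hk⟩ := differentiableAt_moments hγ hd
  have hzero : (fun x => robustRisk 0 γ (law x)) =ᶠ[𝓝 x₀]
      fun x => lawMean (law x) + lawCov γ (law x) := hb.mono fun x hx => robustRisk_zero hγ hx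
  refine ⟨(hm.add hk).congr_of_eventuallyEq hzero, ?_⟩
  rw [hzero.fderiv_eq]
  have hspos : ∀ᶠ x in 𝓝 x₀, 0 < lawVar (law x) := hs.continuousAt.eventually (lt_mem_nhds hv)
  have hepos : ∀ᶠ e in 𝓝[>] (0 : ℝ≥0), 0 < e := self_mem_nhdsWithin
  -- it suffices to find a formula with the right derivative
  suffices h : ∃ ψ : ℝ → X → ℝ,
      (∀ᶠ e in 𝓝[>] (0 : ℝ≥0), (fun x => robustRisk e γ (law x)) =ᶠ[𝓝 x₀] ψ e) ∧
      (∀ᶠ e in 𝓝 (0 : ℝ), DifferentiableAt ℝ (ψ e) x₀) ∧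
      Tendsto (fun e => fderiv ℝ (ψ e) x₀) (𝓝 0)
        (𝓝 (fderiv ℝ (fun x => lawMean (law x) + lawCov γ (law x)) x₀)) by
    obtain ⟨ψ, h1, h2, h3⟩ := h
    refine ⟨?_, (h3.comp tendsto_coe_nhdsGT_zero).congr' (h1.mono fun e he => he.fderiv_eq.symm)⟩
    filter_upwards [h1, tendsto_coe_nhdsGT_zero.eventually h2] with e he he'
      using he'.congr_of_eventuallyEq he
  rcases (weightVar_nonneg hγ).eq_or_lt with hG | hG
  · have hcov : ∀ᶠ x in 𝓝 x₀, lawCov γ (law x) = 0 := hb.mono fun x hx => by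
      have := lawCov_sq_le hγ hx
      rw [← hG, mul_zero] at this
      exact pow_eq_zero_iff two_ne_zero |>.1 (le_antisymm this (sq_nonneg _))
    refine ⟨fun _ x => lawMean (law x) + lawCov γ (law x), Eventually.of_forall fun e => ?_,
      Eventually.of_forall fun e => hm.add hk, tendsto_const_nhds⟩
    filter_upwards [hb, hcov] with x hx h0
    rw [robustRisk_of_weightVar_eq_zero hγ hx hG.symm, h0, add_zero]
  rcases (lawCov_sq_le hγ hb.self_of_nhds).lt_or_eq with hlt | heq
  · have hW : 0 < weightVar γ * lawVar (law x₀) - lawCov γ (law x₀) ^ 2 := by linarith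
    refine ⟨_, ?_, differentiableAt_binding_formula hm hs hk hv hW⟩
    -- The neighbourhood of `x₀` may shrink with `e`, since only the germ at `x₀` matters for the
    -- derivative.
    have hcont : ∀ f : ℝ × ℝ × ℝ → ℝ, Continuous f →
        0 < f (0, lawVar (law x₀), lawCov γ (law x₀)) →
        ∀ᶠ e : ℝ≥0 in 𝓝[>] 0, ∀ᶠ x in 𝓝 x₀, 0 < f (e, lawVar (law x), lawCov γ (law x)) := by
      intro f hf h0
      have h1 : ∀ᶠ e in 𝓝 (0 : ℝ), ∀ᶠ q in 𝓝 (lawVar (law x₀), lawCov γ (law x₀)),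
          0 < f (e, q) := (hf.continuousAt.eventually (lt_mem_nhds h0)).curry_nhds
      filter_upwards [tendsto_coe_nhdsGT_zero.eventually h1] with e he
      exact (hs.continuousAt.prodMk hk.continuousAt).eventually he
    have hK := hcont (fun p => p.2.1 - p.1 ^ 2 / 2) (by fun_prop) (by simpa using hv)
    have hbind := hcont (fun p => (p.2.1 - p.1 ^ 2 / 2) ^ 2 * (weightVar γ * p.2.1 - p.2.2 ^ 2) -
      p.2.2 ^ 2 * (p.2.1 ^ 2 - (p.2.1 - p.1 ^ 2 / 2) ^ 2)) (by fun_prop)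
      (by simpa using mul_pos (pow_pos hv 2) hW)
    have hWx : ∀ᶠ x in 𝓝 x₀, 0 < weightVar γ * lawVar (law x) - lawCov γ (law x) ^ 2 :=
      ((hs.continuousAt.const_mul _).sub (hk.continuousAt.pow 2)).eventually (lt_mem_nhds hW)
    filter_upwards [hK, hbind, hepos] with e hK hbind he
    filter_upwards [hK, hbind, hb, hspos, hWx] with x hK hbind hx hsx hWx
    exact robustRisk_eq_of_binding hγ hx he hsx hK hWx (sub_pos.1 hbind).le
  · -- the covariance has its largest possible value at `x₀`
    have hk0 : lawCov γ (law x₀) = √(lawVar (law x₀)) * √(weightVar γ) := by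
      rw [← Real.sqrt_mul hv.le, ← heq, Real.sqrt_sq (lawCov_nonneg hγ hb.self_of_nhds)]
    have hsq : DifferentiableAt ℝ (fun x => √(lawVar (law x)) * √(weightVar γ)) x₀ :=
      (hs.sqrt hv.ne').mul_const _
    -- By Cauchy-Schwarz this difference is nonnegative, and it vanishes at `x₀`; hence `√s √G` and
    -- `k` have the same derivative there.
    have hmin : IsLocalMin
        (fun x => √(lawVar (law x)) * √(weightVar γ) - lawCov γ (law x)) x₀ := by
      filter_upwards [hb, hspos] with x hx hsx
      rw [← hk0, sub_self, sub_nonneg, ← Real.sqrt_mul hsx.le]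
      exact Real.le_sqrt_of_sq_le (lawCov_sq_le hγ hx)
    have hder := hmin.fderiv_eq_zero
    rw [fderiv_fun_sub hsq hk, sub_eq_zero] at hder
    refine ⟨fun _ x => lawMean (law x) + √(lawVar (law x)) * √(weightVar γ), ?_,
      Eventually.of_forall fun e => hm.add hsq, ?_⟩
    · filter_upwards [hepos] with e he
      have he2 : (0 : ℝ) < (e : ℝ) ^ 2 := by
        have : (0 : ℝ) < e := he
        positivity
      have hc : ContinuousAt (fun x => lawCov γ (law x) -
          constK e (law x) * (√(weightVar γ) / √(lawVar (law x)))) x₀ := by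
        refine hk.continuousAt.sub ((hs.continuousAt.sub continuousAt_const).mul
          (continuousAt_const.div hs.continuousAt.sqrt (Real.sqrt_pos.2 hv).ne'))
      -- At `x₀` the slack equals `e²/2 * √G / √s`, which is positive; by continuity the constraint
      -- stays slack nearby.
      have h0 : 0 < lawCov γ (law x₀) -
          constK e (law x₀) * (√(weightVar γ) / √(lawVar (law x₀))) := by
        have h1 := Real.sqrt_pos.2 hv
        have h2 := Real.sqrt_pos.2 hG
        have h3 : lawVar (law x₀) * (√(weightVar γ) / √(lawVar (law x₀))) =
            lawCov γ (law x₀) := by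
          rw [hk0]
          nth_rw 1 [← Real.sq_sqrt hv.le]
          field_simp
        rw [constK, sub_mul, h3, sub_sub_cancel]
        positivity
      filter_upwards [hc.eventually (lt_mem_nhds h0), hb, hspos] with x h1 hx hsx
      exact robustRisk_eq_of_not_binding hγ hx hsx hG (sub_pos.1 h1).le
    · beta_reduce
      rw [fderiv_fun_add hm hsq, fderiv_fun_add hm hk, hder]
      exact tendsto_const_nhds

end Differentiability

/-! ### The multipliers for vanishing tolerance -/

/-- After both signs are flipped, the numerator has a positive limit while `s² - K² = e² (s - e²/4)`
decreases to `0` through positive values. -/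
theorem tendsto_discr {γ : ℝ → ℝ} {ν : Measure ℝ} (hs : 0 < lawVar ν)
    (h : lawCov γ ν ^ 2 < lawVar ν * weightVar γ) :
    Tendsto (fun e : ℝ≥0 => discr e γ ν) (𝓝[>] 0) atTop := by
  have hnum : Tendsto (fun e : ℝ≥0 => 4 * constK e ν ^ 2 *
      (lawVar ν * weightVar γ - lawCov γ ν ^ 2)) (𝓝[>] 0)
      (𝓝 (4 * lawVar ν ^ 2 * (lawVar ν * weightVar γ - lawCov γ ν ^ 2))) := by
    have hc : ContinuousAt (fun x : ℝ => 4 * (lawVar ν - x ^ 2 / 2) ^ 2 *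
      (lawVar ν * weightVar γ - lawCov γ ν ^ 2)) 0 := by fun_prop
    simpa [Function.comp_def, constK] using hc.tendsto.comp tendsto_coe_nhdsGT_zero
  have hden : Tendsto (fun e : ℝ≥0 => lawVar ν ^ 2 - constK e ν ^ 2) (𝓝[>] 0) (𝓝[>] 0) := by
    refine tendsto_nhdsWithin_iff.2 ⟨?_, ?_⟩
    · have hc : ContinuousAt (fun x : ℝ => lawVar ν ^ 2 - (lawVar ν - x ^ 2 / 2) ^ 2) 0 := by
        fun_prop
      simpa [Function.comp_def, constK] using hc.tendsto.comp tendsto_coe_nhdsGT_zero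
    · have hc : ContinuousAt (fun x : ℝ => lawVar ν - x ^ 2 / 4) 0 := by fun_prop
      have hpos := tendsto_coe_nhdsGT_zero.eventually
        (hc.eventually (lt_mem_nhds (by simpa using hs)))
      filter_upwards [hpos, self_mem_nhdsWithin] with e he he0
      have he0' : (0 : ℝ) < e := he0
      have : lawVar ν ^ 2 - constK e ν ^ 2 = (e : ℝ) ^ 2 * (lawVar ν - (e : ℝ) ^ 2 / 4) := by
        rw [constK]
        ring
      rw [Set.mem_Ioi, this]
      positivity
  refine (hnum.pos_mul_atTop ?_ hden.inv_tendsto_nhdsGT_zero).congr fun e => ?_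
  · have := sub_pos.2 h
    positivity
  · simp only [Pi.inv_apply]
    rw [discr, ← div_eq_mul_inv, ← neg_div_neg_eq, neg_sub]
    ring

theorem tendsto_lamStar {γ : ℝ → ℝ} {ν : Measure ℝ} (hs : 0 < lawVar ν)
    (h : lawCov γ ν ^ 2 < lawVar ν * weightVar γ) :
    Tendsto (fun e : ℝ≥0 => lamStar e γ ν) (𝓝[>] 0) atTop :=
  (tendsto_atTop_add_const_left _ _
    (Real.tendsto_sqrt_atTop.comp (tendsto_discr hs h))).atTop_div_const (by positivity)

/-- With `y = 1 / lamStar`, the ratio is `√(s + G y² + 2 k y) / √s`, which is continuous at `y = 0`.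
-/
theorem tendsto_bStar_div_lamStar {γ : ℝ → ℝ} {ν : Measure ℝ} (hs : 0 < lawVar ν)
    (h : lawCov γ ν ^ 2 < lawVar ν * weightVar γ) :
    Tendsto (fun e : ℝ≥0 => bStar e γ ν / lamStar e γ ν) (𝓝[>] 0) (𝓝 1) := by
  have hl := tendsto_lamStar hs h
  have hc : ContinuousAt (fun y : ℝ => √(lawVar ν + weightVar γ * y ^ 2 + 2 * lawCov γ ν * y) /
      √(lawVar ν)) 0 := by fun_prop
  have hlim := hc.tendsto.comp hl.inv_tendsto_atTop
  have h0 : √(lawVar ν) ≠ 0 := (Real.sqrt_pos.2 hs).ne'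
  simp only [ne_eq, OfNat.ofNat_ne_zero, not_false_eq_true, zero_pow, mul_zero, add_zero,
    div_self h0] at hlim
  refine hlim.congr' ?_
  filter_upwards [hl.eventually_gt_atTop 0] with e he
  simp only [Function.comp_apply, Pi.inv_apply, bStar]
  rw [div_right_comm]
  congr 1
  rw [eq_div_iff he.ne']
  nth_rw 3 [← Real.sqrt_sq he.le]
  rw [← Real.sqrt_mul' _ (sq_nonneg _)]
  congr 1
  field_simp

theorem tendsto_bStar {γ : ℝ → ℝ} {ν : Measure ℝ} (hs : 0 < lawVar ν)
    (h : lawCov γ ν ^ 2 < lawVar ν * weightVar γ) :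
    Tendsto (fun e : ℝ≥0 => bStar e γ ν) (𝓝[>] 0) atTop := by
  have hl := tendsto_lamStar hs h
  refine ((tendsto_bStar_div_lamStar hs h).pos_mul_atTop one_pos hl).congr' ?_
  filter_upwards [hl.eventually_gt_atTop 0] with e he
  exact div_mul_cancel₀ _ he.ne'

/-! ### Tolerances and the backward recursion -/

namespace RiskMDP

variable {S A : Type*} [MeasurableSpace S] [MeasurableSpace A]

/-- The Q-function depends only on the present and future tolerances. -/
theorem qRec_congr (M : RiskMDP S A) {ε ε' : ℕ → S → ℝ≥0} (π : ℕ → S → A) (n : ℕ) :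
    ∀ {t : ℕ}, (∀ r, t ≤ r → ε r = ε' r) → M.qRec ε π n t = M.qRec ε' π n t := by
  induction n with
  | zero => intro t _; rfl
  | succ n ih =>
    intro t h
    funext s a
    simp only [qRec]
    rw [h t le_rfl, ih fun r hr => h r (by omega)]

theorem costLaw_setTol (M : RiskMDP S A) (ε : ℕ → S → ℝ≥0) (π : ℕ → S → A) (t : ℕ) (s : S)
    (e : ℝ≥0) (s' : S) (a : A) : M.costLaw (setTol ε t s e) π t s' a = M.costLaw ε π t s' a := by
  have h : M.valueFn (setTol ε t s e) π (t + 1) = M.valueFn ε π (t + 1) := by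
    funext s''
    unfold valueFn qFn
    rw [qRec_congr]
    intro r hr
    funext x
    exact if_neg fun hx => by omega
  unfold costLaw costToGo
  rw [h]

theorem qFn_setTol (M : RiskMDP S A) (ε : ℕ → S → ℝ≥0) (π : ℕ → S → A) {t : ℕ}
    (ht : t ≤ M.horizon) (s : S) (e : ℝ≥0) (a : A) :
    M.qFn (setTol ε t s e) π t s a =
      robustRisk e (M.weight t s) (M.costLaw ε π t s a) := by
  rw [M.qFn_eq _ _ ht, costLaw_setTol]
  simp [setTol]

theorem isBoundedLaw_costLaw (M : RiskMDP S A) {ε : ℕ → S → ℝ≥0} {π : ℕ → S → A} {t : ℕ} {s : S}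
    {a : A} (h : MemLp (M.costToGo ε π t s a) ⊤ (M.trans t (s, a))) :
    IsBoundedLaw (M.costLaw ε π t s a) := by
  have := M.markov t
  have hm := h.aestronglyMeasurable.aemeasurable
  refine ⟨Measure.isProbabilityMeasure_map hm,
    (eLpNormEssSup (M.costToGo ε π t s a) (M.trans t (s, a))).toReal, ?_⟩
  refine (ae_map_iff hm (measurableSet_le (measurable_norm (α := ℝ)) measurable_const)).2 ?_
  have hfin : eLpNormEssSup (M.costToGo ε π t s a) (M.trans t (s, a)) ≠ ⊤ := by
    simpa using h.eLpNorm_ne_top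
  filter_upwards [ae_le_eLpNormEssSup (f := M.costToGo ε π t s a)] with x hx
  simpa using ENNReal.toReal_mono hfin hx

end RiskMDP

end RobustRL

open RobustRL
theorem mainTheorem5 {S A Θ : Type*} [MeasurableSpace S]
    [NormedAddCommGroup A] [NormedSpace ℝ A] [MeasurableSpace A]
    [NormedAddCommGroup Θ] [NormedSpace ℝ Θ]
    (M : RobustRL.RiskMDP S A) (ε : ℕ → S → ℝ≥0) (π : Θ → ℕ → S → A)
    (t : ℕ) (ht : t ≤ M.horizon) (s : S) (θ : Θ)
    (hπ : DifferentiableAt ℝ (fun η => π η t s) θ)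
    (hbdd : ∀ᶠ a in 𝓝 (π θ t s), MemLp (M.costToGo ε (π θ) t s a) ⊤ (M.trans t (s, a)))
    (hdiff : RobustRL.L2QuantileDifferentiableAt (M.costLaw ε (π θ) t s) (π θ t s))
    (hvar : 0 < RobustRL.lawVar (M.costLaw ε (π θ) t s (π θ t s))) :
    -- the Q-function with zero tolerance at `s` is differentiable in the action,
    -- and it is the limit of the robust ones together with its derivative
    DifferentiableAt ℝ (M.qFn (RobustRL.setTol ε t s 0) (π θ) t s) (π θ t s) ∧
    (∀ᶠ e in 𝓝[>] (0 : ℝ≥0),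
      DifferentiableAt ℝ (M.qFn (RobustRL.setTol ε t s e) (π θ) t s) (π θ t s)) ∧
    Tendsto (fun e : ℝ≥0 =>
        fderiv ℝ (M.qFn (RobustRL.setTol ε t s e) (π θ) t s) (π θ t s))
      (𝓝[>] 0)
      (𝓝 (fderiv ℝ (M.qFn (RobustRL.setTol ε t s 0) (π θ) t s) (π θ t s))) ∧
    -- the policy gradient, through the action taken in `s` at time `t`
    (∀ᶠ e in 𝓝[>] (0 : ℝ≥0),
      DifferentiableAt ℝ
        (fun η => M.qFn (RobustRL.setTol ε t s e) (π θ) t s (π η t s)) θ) ∧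
    Tendsto (fun e : ℝ≥0 =>
        fderiv ℝ (fun η => M.qFn (RobustRL.setTol ε t s e) (π θ) t s (π η t s)) θ)
      (𝓝[>] 0)
      (𝓝 ((fderiv ℝ (M.qFn (RobustRL.setTol ε t s 0) (π θ) t s) (π θ t s)).comp
        (fderiv ℝ (fun η => π η t s) θ))) ∧
    -- the total gradient of the value function, later periods included
    ((∀ᶠ p in 𝓝 (π θ t s, θ),
        MemLp (M.costToGo ε (π p.2) t s p.1) ⊤ (M.trans t (s, p.1))) →
      RobustRL.L2QuantileDifferentiableAt
        (fun p : A × Θ => M.costLaw ε (π p.2) t s p.1) (π θ t s, θ) →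
      (∀ᶠ e in 𝓝[>] (0 : ℝ≥0),
        DifferentiableAt ℝ
          (fun η => M.valueFn (RobustRL.setTol ε t s e) (π η) t s) θ) ∧
      DifferentiableAt ℝ
        (fun η => M.qFn (RobustRL.setTol ε t s 0) (π η) t s (π θ t s)) θ ∧
      Tendsto (fun e : ℝ≥0 =>
          fderiv ℝ (fun η => M.valueFn (RobustRL.setTol ε t s e) (π η) t s) θ)
        (𝓝[>] 0)
        (𝓝 ((fderiv ℝ (M.qFn (RobustRL.setTol ε t s 0) (π θ) t s) (π θ t s)).comp
            (fderiv ℝ (fun η => π η t s) θ) +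
          fderiv ℝ
            (fun η => M.qFn (RobustRL.setTol ε t s 0) (π η) t s (π θ t s)) θ))) ∧
    -- the multipliers
    (RobustRL.lawCov (M.weight t s) (M.costLaw ε (π θ) t s (π θ t s)) ^ 2 <
        RobustRL.lawVar (M.costLaw ε (π θ) t s (π θ t s)) *
          RobustRL.weightVar (M.weight t s) →
      Tendsto (fun e : ℝ≥0 => RobustRL.lamStar e (M.weight t s)
        (M.costLaw ε (π θ) t s (π θ t s))) (𝓝[>] 0) atTop ∧
      Tendsto (fun e : ℝ≥0 => RobustRL.bStar e (M.weight t s)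
        (M.costLaw ε (π θ) t s (π θ t s))) (𝓝[>] 0) atTop ∧
      Tendsto (fun e : ℝ≥0 =>
        RobustRL.lamStar e (M.weight t s) (M.costLaw ε (π θ) t s (π θ t s)) /
          RobustRL.bStar e (M.weight t s) (M.costLaw ε (π θ) t s (π θ t s)))
        (𝓝[>] 0) (𝓝 1)) := by
  have hγ := M.weight_distortion t s
  set Q : ℝ≥0 → A → Θ → ℝ := fun e a η =>
    robustRisk e (M.weight t s) (M.costLaw ε (π η) t s a) with hQ
  have hq : ∀ e η, M.qFn (setTol ε t s e) (π η) t s = fun a => Q e a η :=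
    fun e η => funext fun a => M.qFn_setTol ε (π η) ht s e a
  have hvf : ∀ e η, M.valueFn (setTol ε t s e) (π η) t s = Q e (π η t s) η :=
    fun e η => M.qFn_setTol ε (π η) ht s e (π η t s)
  simp only [hq, hvf]
  obtain ⟨h1, h2, h3⟩ := tendsto_fderiv_robustRisk hγ
    (hbdd.mono fun a ha => M.isBoundedLaw_costLaw ha) hdiff hvar
  obtain ⟨h4, h5⟩ := tendsto_fderiv_comp hπ h2 h3
  refine ⟨h1, h2, h3, h4, h5, fun hbdd' hdiff' => ?_, fun h => ⟨tendsto_lamStar hvar h,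
    tendsto_bStar hvar h, by simpa using (tendsto_bStar_div_lamStar hvar h).inv₀ one_ne_zero⟩⟩
  -- The same convergence result on the product space `A × Θ`, then composed with the curve `η ↦ (π
  -- η t s, η)`; the limit splits into the action part and the part of the later periods.
  obtain ⟨j1, j2, j3⟩ := tendsto_fderiv_robustRisk hγ
    (hbdd'.mono fun p hp => M.isBoundedLaw_costLaw hp) hdiff' hvar
  obtain ⟨j4, j5⟩ :=
    tendsto_fderiv_comp (f := fun η => (π η t s, η)) (hπ.prodMk differentiableAt_id) j2 j3
  obtain ⟨j6, j7⟩ := fderiv_comp_prodMk (f := fun η => π η t s) hπ j1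
  exact ⟨j4, j6, j7 ▸ j5⟩
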